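/- Let $p$ be an odd prime and $s\ge 1$ an integer. For a rational number $x$ and an integer $n\ge 0$ let $(x)_n=x(x+1)\cdots(x+n-1)$ (so $(x)_0=1$ and $(1)_n=n!$), and for $m\ge 0$ let $H_m^{(2)}=\sum_{i=1}^m \frac{1}{i^2}$. Then $$\sum_{\substack{i,j\ge 0\\ i+j\le p^s-1}}(4i+1)(4j+1)\frac{(\frac12)_i^6(\frac12)_j^6}{(1)_i^6(1)_j^6}\equiv p^{2s}\left(\sum_{k=0}^{(p^s-1)/2}\frac{(\frac12)_k^4}{(1)_k^4}\right)\left(\sum_{k=0}^{(p^s-1)/2}\frac{(\frac12)_k^4}{(1)_k^4}\Bigl\{1-2p^{2s}H_{2k}^{(2)}\Bigr\}\right)\pmod{p^{s+5}}.$$ Here a congruence $x\equiv y\pmod{p^m}$ between rational numbers means that $x-y=p^m c$ for some rational number $c$ whose denominator in lowest terms is not divisible by $p$. -/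

import Mathlib

/-- The shifted factorial `(x)_n = x (x + 1) ⋯ (x + n - 1)` of a rational number `x`. -/
noncomputable def shiftedFactorial (x : ℚ) (n : ℕ) : ℚ :=
  (ascPochhammer ℚ n).eval x

/-- The harmonic number of order two, `H_m^{(2)} = ∑_{i=1}^m 1 / i ^ 2`. -/
def harmonicTwo (m : ℕ) : ℚ :=
  ∑ i ∈ Finset.Icc 1 m, 1 / (i : ℚ) ^ 2

/-- Congruence of rational numbers modulo `p ^ m`: the difference is `p ^ m` times a rational
number whose denominator in lowest terms is not divisible by `p`. -/
def RatCongrModPow (p m : ℕ) (x y : ℚ) : Prop :=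
  ∃ c : ℚ, ¬ p ∣ c.den ∧ x - y = (p : ℚ) ^ m * c

/-! Write n = p^s = 2M + 1, a_k = (1/2)_k / k!, and S for the sum of (4k + 1) a_k^6 over k ≤ M. The
triangular double sum is S² plus twice a tail, which pairs each term with index j > M with the
truncated sum of length n - j (`triangle_sum`).

The tail vanishes modulo p^(s+5). Expand a_k^4 in the polynomials (-k)_j (k + 1/2)_j, against which
the weight (4k + 1) a_k² sums in closed form. The sum truncated at N is then N a_N times a
p-integral number (`sixthSum_eq_mul`). Now p^s divides a_j · (n - j) a_{n-j}, and p divides each of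
the five remaining factors a_j when j > M. At N = M + 1 the same factorization shows that p^s
divides S.

For S itself, deform by ±n/2 and ±in/2 and apply Whipple's transformation (`whipple_sum`). The
deformed left side differs from S only through fourth powers of n/j, whose first-order effect
cancels modulo p^5 under k ↦ M - k (`PDvd.sum_mul_altFourth`). The right side is n ∑ a_j^4 (1 - n²
H_{2j}^{(2)}) modulo p^5. Hence S ≡ n(A - B) modulo p^5, with A = ∑ a_k^4 and B = ∑ a_k^4 n²
H_{2k}^{(2)}.

Both S and n(A - B) are divisible by p^s, so factoring the difference of their squares gives S² ≡
n²(A - B)² modulo p^(s+5). Finally p² divides B, so n²B² is negligible and n²A(A - 2B) remains. -/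

/-- `PDvd p m x` says that the rational number `x` is `p ^ m` times a `p`-integral number. -/
def PDvd (p m : ℕ) (x : ℚ) : Prop :=
  padicNorm p x ≤ ((p : ℚ) ^ m)⁻¹

/-! ### Arithmetic of p-adic divisibility in ℚ. -/

namespace PDvd

lemma neg {p m : ℕ} {x : ℚ} (hx : PDvd p m x) : PDvd p m (-x) := by
  rwa [PDvd, padicNorm.neg]

variable {p m l : ℕ} [Fact p.Prime] {x y : ℚ}

lemma prime_cast_pos (p : ℕ) [Fact p.Prime] : (0 : ℚ) < p :=
  Nat.cast_pos.2 (Fact.out : p.Prime).pos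

lemma zero (p m : ℕ) [Fact p.Prime] : PDvd p m 0 := by
  have := prime_cast_pos p
  simp only [PDvd, padicNorm.zero]
  positivity

lemma add (hx : PDvd p m x) (hy : PDvd p m y) : PDvd p m (x + y) :=
  padicNorm.nonarchimedean.trans (max_le hx hy)

lemma sub (hx : PDvd p m x) (hy : PDvd p m y) : PDvd p m (x - y) :=
  padicNorm.sub.trans (max_le hx hy)

lemma mul (hx : PDvd p m x) (hy : PDvd p l y) : PDvd p (m + l) (x * y) := by
  rw [PDvd, padicNorm.mul, pow_add, mul_inv]
  exact mul_le_mul hx hy (padicNorm.nonneg _) ((padicNorm.nonneg _).trans hx)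

lemma mono (h : l ≤ m) (hx : PDvd p m x) : PDvd p l x := by
  have hp : (1 : ℚ) ≤ p := Nat.one_le_cast.2 (Fact.out : p.Prime).one_le
  refine hx.trans (inv_anti₀ (by positivity) (pow_le_pow_right₀ hp h))

lemma mul_left (hy : PDvd p 0 y) (hx : PDvd p m x) : PDvd p m (y * x) := by
  simpa using mul hy hx

lemma mul_right (hx : PDvd p m x) (hy : PDvd p 0 y) : PDvd p m (x * y) := by
  simpa using mul hx hy

lemma integral (hx : PDvd p m x) : PDvd p 0 x := hx.mono (Nat.zero_le m)

lemma sum {ι : Type*} {s : Finset ι} {f : ι → ℚ} (h : ∀ i ∈ s, PDvd p m (f i)) :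
    PDvd p m (∑ i ∈ s, f i) :=
  Finset.sum_induction f (PDvd p m) (fun _ _ => add) (zero p m) h

lemma pow (hx : PDvd p m x) (k : ℕ) : PDvd p (m * k) (x ^ k) := by
  induction k with
  | zero => simp [PDvd]
  | succ k ih => rw [pow_succ, Nat.mul_succ]; exact ih.mul hx

lemma int (p : ℕ) [Fact p.Prime] (z : ℤ) : PDvd p 0 z := by
  simpa [PDvd] using padicNorm.of_int z

lemma nat (p : ℕ) [Fact p.Prime] (k : ℕ) : PDvd p 0 k := by
  simpa using int p k

lemma one (p : ℕ) [Fact p.Prime] : PDvd p 0 1 := by simpa using nat p 1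

lemma pow_iff_dvd {k : ℕ} : PDvd p m k ↔ p ^ m ∣ k := by
  have := padicNorm.dvd_iff_norm_le (p := p) (n := m) (z := k)
  rw [Int.natCast_dvd_natCast] at this
  rw [this, PDvd]
  simp

lemma prime_pow (p m : ℕ) [Fact p.Prime] : PDvd p m ((p : ℚ) ^ m) := by
  have := (pow_iff_dvd (p := p) (m := m) (k := p ^ m)).2 dvd_rfl
  simpa using this

lemma inv_of_not_dvd {k : ℕ} (h : ¬ p ∣ k) : PDvd p 0 ((k : ℚ)⁻¹) := by
  have h1 := (padicNorm.nat_eq_one_iff (p := p) k).2 h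
  have h2 := padicNorm.div (p := p) 1 k
  rw [h1, padicNorm.one, one_div] at h2
  simp [PDvd, h2]

/-- Inverses of numbers congruent to `1` modulo `p` are `p`-integral. -/
lemma inv_one_add (hx : PDvd p 1 x) : PDvd p 0 ((1 + x)⁻¹) := by
  have hp : (1 : ℚ) < p := Nat.one_lt_cast.2 (Fact.out : p.Prime).one_lt
  have hx1 : padicNorm p x < 1 := by
    refine lt_of_le_of_lt hx ?_
    rw [pow_one]
    exact inv_lt_one_of_one_lt₀ hp
  have h1 : padicNorm p (1 + x) = 1 := by
    rw [padicNorm.add_eq_max_of_ne (by rw [padicNorm.one]; exact hx1.ne'), padicNorm.one,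
      max_eq_left hx1.le]
  have h2 := padicNorm.div (p := p) 1 (1 + x)
  rw [h1, padicNorm.one, one_div] at h2
  simp [PDvd, h2]

lemma ratCongr (h : PDvd p m (x - y)) : RatCongrModPow p m x y := by
  have hp := prime_cast_pos p
  refine ⟨(x - y) / (p : ℚ) ^ m, ?_, by field_simp⟩
  set c := (x - y) / (p : ℚ) ^ m with hc
  have hn : padicNorm p c ≤ 1 := by
    have h1 : padicNorm p ((p : ℚ) ^ m) = ((p : ℚ) ^ m)⁻¹ := by
      clear h hc
      induction m with
      | zero => simp
      | succ m ih => rw [pow_succ, padicNorm.mul, ih, padicNorm.padicNorm_p_of_prime, mul_inv]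
    rw [hc, padicNorm.div, h1, div_inv_eq_mul]
    calc _ ≤ ((p : ℚ) ^ m)⁻¹ * (p : ℚ) ^ m := by gcongr; exact h
      _ = 1 := inv_mul_cancel₀ (by positivity)
  intro hd
  have hden : padicNorm p (c.den : ℚ) < 1 := (padicNorm.nat_lt_one_iff _).2 hd
  have hnum : ¬ (p : ℤ) ∣ c.num := by
    intro h'
    have h1 : p ∣ c.num.natAbs := Int.natCast_dvd.1 h'
    have h2 := Nat.dvd_gcd h1 hd
    rw [c.reduced.gcd_eq_one] at h2
    exact (Fact.out : p.Prime).one_lt.ne' (Nat.dvd_one.1 h2)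
  have h1 := (padicNorm.int_eq_one_iff (p := p) c.num).2 hnum
  have h2 : (c.num : ℚ) = c * c.den := (Rat.mul_den_eq_num c).symm
  rw [h2, padicNorm.mul] at h1
  nlinarith [padicNorm.nonneg (p := p) c, padicNorm.nonneg (p := p) (c.den : ℚ)]

/-- `p ^ s / j` is divisible by `p` if `0 < j < p ^ s`. -/
lemma prime_pow_div {s j : ℕ} (h0 : 0 < j) (hj : j < p ^ s) :
    PDvd p 1 ((p : ℚ) ^ s / j) := by
  have hp := (Fact.out : p.Prime)
  obtain ⟨e, r, hr, rfl⟩ := Nat.exists_eq_pow_mul_and_not_dvd h0.ne' p hp.ne_one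
  have hr0 : 0 < r := Nat.pos_of_ne_zero (by rintro rfl; simp at hr)
  have he : e < s := by
    by_contra! hle
    have := Nat.pow_le_pow_right hp.pos hle
    nlinarith
  have hpq := prime_cast_pos p
  have : (p : ℚ) ^ s / ((p ^ e * r : ℕ) : ℚ) = (p : ℚ) ^ (s - e) * (r : ℚ)⁻¹ := by
    obtain ⟨d, rfl⟩ := Nat.exists_eq_add_of_lt he
    have : e + d + 1 - e = d + 1 := by omega
    rw [this]
    push_cast
    field_simp
    ring
  rw [this]
  exact ((prime_pow p (s - e)).mul_right (inv_of_not_dvd hr)).mono (by omega)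

end PDvd

/-! ### Shifted factorials and well-poised products. -/

/-- The normalized shifted factorial `(x)_m / m!`. -/
def risingBinom (x : ℚ) (m : ℕ) : ℚ :=
  ∏ i ∈ Finset.range m, (x + i) / (i + 1)

/-- The well-poised basis polynomials `(-x)_j (x + 1/2)_j`. -/
def poisedBasis (j : ℕ) (x : ℚ) : ℚ :=
  ∏ i ∈ Finset.range j, (i - x) * (x + 1 / 2 + i)

/-- The product of `(i + 1/2) ^ 2 - z` over `i < j`. -/
def halfFactor (z : ℚ) (j : ℕ) : ℚ :=
  ∏ i ∈ Finset.range j, (((i : ℚ) + 1 / 2) ^ 2 - z)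

/-- The product of `(i + 1) ^ 2 - z` over `i < j`. -/
def oneFactor (z : ℚ) (j : ℕ) : ℚ :=
  ∏ i ∈ Finset.range j, (((i : ℚ) + 1) ^ 2 - z)

lemma risingBinom_zero (x : ℚ) : risingBinom x 0 = 1 := by simp [risingBinom]

lemma risingBinom_succ (x : ℚ) (m : ℕ) :
    risingBinom x (m + 1) = risingBinom x m * ((x + m) / (m + 1)) := by
  rw [risingBinom, Finset.prod_range_succ, risingBinom]

lemma risingBinom_add_one_mul (x : ℚ) (m : ℕ) :
    risingBinom (x + 1) m * x = risingBinom x m * (x + m) := by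
  induction m with
  | zero => simp [risingBinom]
  | succ m ih =>
    rw [risingBinom_succ, risingBinom_succ]
    have : (m : ℚ) + 1 ≠ 0 := by positivity
    field_simp
    push_cast
    linear_combination (x + 1 + m) * ih

lemma risingBinom_pascal (x : ℚ) (m : ℕ) :
    risingBinom (x + 1) (m + 1) = risingBinom (x + 1) m + risingBinom x (m + 1) := by
  have h := risingBinom_add_one_mul x m
  rw [risingBinom_succ, risingBinom_succ]
  have : (m : ℚ) + 1 ≠ 0 := by positivity
  field_simp
  linear_combination h

lemma poisedBasis_zero (x : ℚ) : poisedBasis 0 x = 1 := by simp [poisedBasis]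

lemma poisedBasis_succ (j : ℕ) (x : ℚ) :
    poisedBasis (j + 1) x = poisedBasis j x * ((j - x) * (x + 1 / 2 + j)) := by
  rw [poisedBasis, Finset.prod_range_succ, poisedBasis]

lemma poisedBasis_eq_zero {j k : ℕ} (h : k < j) : poisedBasis j k = 0 :=
  Finset.prod_eq_zero (Finset.mem_range.2 h) (by simp)

lemma poisedBasis_add_one (j : ℕ) (x : ℚ) :
    poisedBasis j (x + 1) * ((x + 1 - j) * (x + 1 / 2)) =
      poisedBasis j x * ((x + 1) * (x + 1 / 2 + j)) := by
  induction j with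
  | zero => simp [poisedBasis]
  | succ j ih =>
    rw [poisedBasis_succ, poisedBasis_succ]
    push_cast
    linear_combination (j - x) * (x + 3 / 2 + j) * ih

lemma halfFactor_zero (z : ℚ) : halfFactor z 0 = 1 := by simp [halfFactor]

lemma halfFactor_succ (z : ℚ) (j : ℕ) :
    halfFactor z (j + 1) = halfFactor z j * (((j : ℚ) + 1 / 2) ^ 2 - z) := by
  rw [halfFactor, Finset.prod_range_succ, halfFactor]

lemma oneFactor_zero (z : ℚ) : oneFactor z 0 = 1 := by simp [oneFactor]

lemma oneFactor_succ (z : ℚ) (j : ℕ) :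
    oneFactor z (j + 1) = oneFactor z j * (((j : ℚ) + 1) ^ 2 - z) := by
  rw [oneFactor, Finset.prod_range_succ, oneFactor]

lemma oneFactor_ne_zero {z : ℚ} (hz : ∀ i : ℕ, ((i : ℚ) + 1) ^ 2 - z ≠ 0) (j : ℕ) :
    oneFactor z j ≠ 0 :=
  Finset.prod_ne_zero_iff.2 fun i _ => hz i

/-! ### Pfaff–Saalschütz summation and expansion in the well-poised basis. -/

/-- The general term of the balanced sum of Pfaff and Saalschütz. -/
def saalTerm (r : ℕ) (z : ℚ) (m l : ℕ) : ℚ :=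
  ∏ i ∈ Finset.range l, ((i : ℚ) - m) * (m + 2 * r + 1 / 2 + i) * (1 / 2 + i) /
    ((i + 1) * (((r + i : ℕ) + 1 : ℚ) ^ 2 - z))

lemma saalTerm_succ (r : ℕ) (z : ℚ) (m l : ℕ) :
    saalTerm r z m (l + 1) = saalTerm r z m l * (((l : ℚ) - m) * (m + 2 * r + 1 / 2 + l) *
      (1 / 2 + l) / ((l + 1) * (((r + l : ℕ) + 1 : ℚ) ^ 2 - z))) := by
  rw [saalTerm, Finset.prod_range_succ, saalTerm]

lemma saalTerm_eq_zero {r : ℕ} {z : ℚ} {m l : ℕ} (h : m < l) : saalTerm r z m l = 0 :=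
  Finset.prod_eq_zero (Finset.mem_range.2 h) (by simp)

lemma saalTerm_shift {r : ℕ} {z : ℚ} (hz : ∀ i : ℕ, ((i : ℚ) + 1) ^ 2 - z ≠ 0) (m l : ℕ) :
    saalTerm r z (m + 1) (l + 1) = saalTerm r z m l * (-(m + 1) * (m + 2 * r + 1 / 2 + l) *
      (m + 2 * r + 1 / 2 + l + 1) * (1 / 2 + l) / ((m + 2 * r + 1 / 2) *
        ((l + 1) * (((r + l : ℕ) + 1 : ℚ) ^ 2 - z)))) := by
  induction l with
  | zero =>
    rw [saalTerm_succ]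
    have h := hz (r + 0)
    have h2 : (m : ℚ) + 2 * r + 1 / 2 ≠ 0 := by positivity
    simp only [saalTerm, Finset.range_zero, Finset.prod_empty]
    push_cast at h ⊢
    field_simp
    ring
  | succ l ih =>
    rw [saalTerm_succ, ih, saalTerm_succ r z m l]
    have h := hz (r + l)
    have h1 := hz (r + (l + 1))
    have h2 : (m : ℚ) + 2 * r + 1 / 2 ≠ 0 := by positivity
    have h3 : (l : ℚ) + 1 + 1 ≠ 0 := by positivity
    push_cast at h h1 ⊢
    generalize ((r : ℚ) + l + 1) ^ 2 - z = A at *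
    generalize ((r : ℚ) + (l + 1) + 1) ^ 2 - z = B at *
    field_simp
    ring

/-- Creative telescoping in `m`: the combination giving a first-order recurrence for the full sum is
an exact difference in `l`, and the right side is its antidifference. At `L = m + 1` this boundary
vanishes. -/
lemma saalTerm_sum_partial {r : ℕ} {z : ℚ} (hz : ∀ i : ℕ, ((i : ℚ) + 1) ^ 2 - z ≠ 0)
    (m L : ℕ) :
    ∑ l ∈ Finset.range (L + 1), ((((r + m : ℕ) + 1 : ℚ) ^ 2 - z) * saalTerm r z (m + 1) l -
      (((r + m : ℕ) + 1 / 2 : ℚ) ^ 2 - z) * saalTerm r z m l) =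
    (2 * r + 2 * m + 3 / 2) / (m + 2 * r + 1 / 2) * (m + 2 * r + 1 / 2 + L) * (L + 1 / 2) *
      saalTerm r z m L := by
  have h2 : (m : ℚ) + 2 * r + 1 / 2 ≠ 0 := by positivity
  induction L with
  | zero =>
    simp only [saalTerm, zero_add, Finset.sum_range_one, Finset.range_zero, Finset.prod_empty]
    push_cast
    field_simp
    ring
  | succ L ih =>
    rw [Finset.sum_range_succ, ih, saalTerm_shift hz, saalTerm_succ]
    have h := hz (r + L)
    have hL : (L : ℚ) + 1 ≠ 0 := by positivity
    push_cast at h ⊢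
    field_simp
    ring

/-- A case of the Pfaff–Saalschütz summation. -/
lemma saalTerm_sum {r : ℕ} {z : ℚ} (hz : ∀ i : ℕ, ((i : ℚ) + 1) ^ 2 - z ≠ 0) (m : ℕ) :
    (∑ l ∈ Finset.range (m + 1), saalTerm r z m l) * (oneFactor z (r + m) * halfFactor z r) =
      halfFactor z (r + m) * oneFactor z r := by
  induction m with
  | zero => simp [saalTerm, mul_comm]
  | succ m ih =>
    have h := saalTerm_sum_partial (r := r) hz m (m + 1)
    rw [saalTerm_eq_zero (Nat.lt_succ_self m), mul_zero, Finset.sum_sub_distrib,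
      ← Finset.mul_sum, ← Finset.mul_sum, Finset.sum_range_succ (saalTerm r z m),
      saalTerm_eq_zero (Nat.lt_succ_self m), add_zero] at h
    rw [← add_assoc, oneFactor_succ, halfFactor_succ]
    linear_combination (oneFactor z (r + m) * halfFactor z r) * h +
      (((r + m : ℕ) + 1 / 2 : ℚ) ^ 2 - z) * ih

lemma saalTerm_mul_poisedBasis {r : ℕ} {z : ℚ} (hz : ∀ i : ℕ, ((i : ℚ) + 1) ^ 2 - z ≠ 0)
    (m l : ℕ) :
    saalTerm r z m l * poisedBasis r (r + m : ℕ) =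
      poisedBasis (r + l) (r + m : ℕ) * risingBinom (1 / 2) l *
        oneFactor z r / oneFactor z (r + l) := by
  induction l with
  | zero =>
    have := oneFactor_ne_zero hz r
    simp [saalTerm, risingBinom]
    field_simp
  | succ l ih =>
    have h1 := oneFactor_ne_zero hz (r + l)
    have h2 := hz (r + l)
    rw [saalTerm_succ, mul_right_comm, ih, ← add_assoc, poisedBasis_succ, risingBinom_succ,
      oneFactor_succ]
    push_cast at h2 ⊢
    field_simp
    ring

/-- Expansion of a well-poised factor in the polynomials `poisedBasis`. -/
lemma halfFactor_div_mul_poisedBasis {z : ℚ} (hz : ∀ i : ℕ, ((i : ℚ) + 1) ^ 2 - z ≠ 0)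
    {r k L : ℕ} (hL : k < r + L) :
    halfFactor z k / oneFactor z k * poisedBasis r k =
      ∑ l ∈ Finset.range L, poisedBasis (r + l) k * risingBinom (1 / 2) l *
        halfFactor z r / oneFactor z (r + l) := by
  rcases lt_or_ge k r with hk | hk
  · rw [poisedBasis_eq_zero hk, mul_zero]
    refine (Finset.sum_eq_zero fun l _ => ?_).symm
    rw [poisedBasis_eq_zero (by omega)]
    simp
  obtain ⟨m, rfl⟩ := Nat.exists_eq_add_of_le hk
  have h := saalTerm_sum (r := r) hz m
  have h1 := oneFactor_ne_zero hz
  -- Terms with `l > m` vanish because `k = r + m` is a root of the basis polynomial, so any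
  -- sufficiently large cutoff `L` is allowed. This permits one cutoff for all `k`.
  have hsub : Finset.range (m + 1) ⊆ Finset.range L := Finset.range_subset_range.2 (by omega)
  rw [← Finset.sum_subset hsub (fun l _ hl => by
    rw [poisedBasis_eq_zero (by simp at hl; omega)]; simp)]
  have h2 : ∀ l ∈ Finset.range (m + 1), poisedBasis (r + l) (r + m : ℕ) * risingBinom (1 / 2) l *
      halfFactor z r / oneFactor z (r + l) =
      saalTerm r z m l * (poisedBasis r (r + m : ℕ) * halfFactor z r / oneFactor z r) := by
    intro l _
    have := saalTerm_mul_poisedBasis (r := r) hz m l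
    have e1 := h1 r
    have e2 := h1 (r + l)
    rw [mul_div_assoc', ← mul_assoc, this]
    field_simp
  rw [Finset.sum_congr rfl h2, ← Finset.sum_mul]
  have e1 := h1 r
  have e2 := h1 (r + m)
  field_simp
  linear_combination -(poisedBasis r (r + m : ℕ)) * h

/-- The summand is an exact difference in `k`; `poisedBasis_add_one` supplies the shift. -/
lemma sum_poisedBasis (j N : ℕ) :
    (2 * j + 1) * ∑ k ∈ Finset.range N,
      (4 * (k : ℚ) + 1) * risingBinom (1 / 2) k ^ 2 * poisedBasis j k =
    4 * N * (N - j) * risingBinom (1 / 2) N ^ 2 * poisedBasis j N := by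
  induction N with
  | zero => simp
  | succ N ih =>
    have h := poisedBasis_add_one j (N : ℚ)
    rw [Finset.sum_range_succ, mul_add, ih, risingBinom_succ]
    have : (N : ℚ) + 1 ≠ 0 := by positivity
    push_cast
    field_simp
    linear_combination (-8 * (2 * (N : ℚ) + 1) * risingBinom (1 / 2) N ^ 2) * h

/-! ### p-integrality at half-integers. -/

lemma risingBinom_half_eq (k : ℕ) :
    risingBinom (1 / 2) k = (Nat.centralBinom k : ℚ) * (4 ^ k)⁻¹ := by
  induction k with
  | zero => simp [risingBinom]
  | succ k ih =>
    have h : ((k + 1 : ℕ) : ℚ) * (Nat.centralBinom (k + 1) : ℚ) =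
        ((2 * (2 * k + 1) : ℕ) : ℚ) * Nat.centralBinom k := by
      exact_mod_cast Nat.succ_mul_centralBinom_succ k
    have h1 : (k : ℚ) + 1 ≠ 0 := by positivity
    rw [risingBinom_succ, ih, pow_succ]
    push_cast at h
    field_simp
    linear_combination -2 * h

lemma PDvd.inv_two_pow {p : ℕ} [Fact p.Prime] (hodd : Odd p) (k : ℕ) :
    PDvd p 0 ((2 ^ k : ℚ)⁻¹) := by
  have h : ¬ p ∣ 2 ^ k := by
    intro h
    have h1 := (Nat.prime_dvd_prime_iff_eq Fact.out Nat.prime_two).1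
      ((Fact.out : p.Prime).dvd_of_dvd_pow h)
    rw [h1] at hodd
    exact absurd hodd (by decide)
  simpa using PDvd.inv_of_not_dvd h

lemma PDvd.of_two_mul {p m : ℕ} [Fact p.Prime] (hodd : Odd p) {x : ℚ} (h : PDvd p m (2 * x)) :
    PDvd p m x := by
  have := (PDvd.inv_two_pow (p := p) hodd 1).mul_left h
  rwa [pow_one, inv_mul_cancel_left₀ two_ne_zero] at this

lemma PDvd.risingBinom_half {p : ℕ} [Fact p.Prime] (hodd : Odd p) (k : ℕ) :
    PDvd p 0 (risingBinom (1 / 2) k) := by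
  rw [risingBinom_half_eq]
  refine (PDvd.nat p _).mul_left ?_
  have := PDvd.inv_two_pow hodd (2 * k)
  rwa [pow_mul, show (2 : ℚ) ^ 2 = 4 by norm_num] at this

/-- Binomial-type products at half-odd integers are `p`-integral for odd `p`. -/
lemma PDvd.risingBinom_int_add_half {p : ℕ} [Fact p.Prime] (hodd : Odd p) (m : ℕ) :
    ∀ z : ℤ, PDvd p 0 (risingBinom (z + 1 / 2) m) := by
  induction m with
  | zero => intro z; rw [risingBinom_zero]; exact PDvd.one p
  | succ m ih =>
    intro z
    -- Pascal's rule moves the argument by one in either direction at the cost of a term of lower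
    -- degree `m`, so the central binomial case at 1/2 reaches every half-odd integer.
    induction z using Int.induction_on with
    | zero => simpa using PDvd.risingBinom_half hodd (m + 1)
    | succ i hi =>
      have h := risingBinom_pascal ((i : ℤ) + 1 / 2 : ℚ) m
      have h2 := ih (i + 1)
      have e : (((i : ℤ) + 1 : ℤ) : ℚ) + 1 / 2 = ((i : ℤ) : ℚ) + 1 / 2 + 1 := by push_cast; ring
      rw [e] at h2 ⊢
      rw [h]
      exact h2.add hi
    | pred i hi =>
      have h := risingBinom_pascal ((-(i : ℤ) - 1 : ℤ) + 1 / 2 : ℚ) m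
      have h2 := ih (-(i : ℤ))
      have e : ((-(i : ℤ) - 1 : ℤ) : ℚ) + 1 / 2 + 1 = ((-(i : ℤ) : ℤ) : ℚ) + 1 / 2 := by
        push_cast; ring
      rw [e] at h
      rw [← sub_eq_iff_eq_add'.2 h]
      exact hi.sub h2

/-! ### Factorization of the truncated sixth power sum. -/

lemma risingBinom_half_sq (k : ℕ) :
    risingBinom (1 / 2) k ^ 2 = halfFactor 0 k / oneFactor 0 k := by
  rw [risingBinom, halfFactor, oneFactor, ← Finset.prod_div_distrib, ← Finset.prod_pow]
  refine Finset.prod_congr rfl fun i _ => ?_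
  rw [div_pow, sub_zero, sub_zero, add_comm]

lemma add_one_sq_sub_zero_ne (i : ℕ) : ((i : ℚ) + 1) ^ 2 - 0 ≠ 0 := by
  rw [sub_zero]; positivity

/-- The basis expansion at `z = 0` is used twice: one factor a_k² is expanded in the polynomials of
index `r`, then the other a_k² times each of these is expanded again. -/
lemma risingBinom_half_pow_four {k N : ℕ} (h : k < N) :
    risingBinom (1 / 2) k ^ 4 = ∑ r ∈ Finset.range N, ∑ l ∈ Finset.range N,
      risingBinom (1 / 2) r ^ 3 * risingBinom (1 / 2) l *
        (poisedBasis (r + l) k / oneFactor 0 (r + l)) := by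
  have h0 := halfFactor_div_mul_poisedBasis add_one_sq_sub_zero_ne (r := 0) (k := k) (L := N)
    (by omega)
  rw [poisedBasis_zero, mul_one, ← risingBinom_half_sq] at h0
  have : risingBinom (1 / 2) k ^ 4 = risingBinom (1 / 2) k ^ 2 * risingBinom (1 / 2) k ^ 2 := by
    ring
  rw [this]
  nth_rewrite 2 [h0]
  rw [Finset.mul_sum]
  refine Finset.sum_congr rfl fun r _ => ?_
  have h1 := halfFactor_div_mul_poisedBasis add_one_sq_sub_zero_ne (r := r) (k := k) (L := N)
    (by omega)
  rw [← risingBinom_half_sq] at h1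
  rw [zero_add, halfFactor_zero, mul_one]
  have h2 : risingBinom (1 / 2) k ^ 2 * (poisedBasis r k * risingBinom (1 / 2) r / oneFactor 0 r) =
      risingBinom (1 / 2) r / oneFactor 0 r * (risingBinom (1 / 2) k ^ 2 * poisedBasis r k) := by
    ring
  rw [h2, h1, Finset.mul_sum]
  refine Finset.sum_congr rfl fun l _ => ?_
  have h3 : risingBinom (1 / 2) r ^ 3 = risingBinom (1 / 2) r * risingBinom (1 / 2) r ^ 2 := by
    ring
  rw [h3, risingBinom_half_sq]
  ring

/-- After N a_N is split off the closed form of `sum_poisedBasis` (upper limit `N + 1` here), the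
quotient by (2j + 1) j!² could still have denominators. This rewrites it through binomial-type
factors, all p-integral for odd p. -/
lemma poisedBasis_eq_choose (N j : ℕ) :
    4 * ((N + 1 : ℕ) - j : ℚ) * risingBinom (1 / 2) (N + 1) * poisedBasis j (N + 1 : ℕ) /
        ((2 * j + 1) * oneFactor 0 j) =
      2 * (-1) ^ j * (N.choose j) * risingBinom (1 / 2) j * risingBinom (j + 3 / 2) N := by
  induction j with
  | zero =>
    have h := risingBinom_add_one_mul (1 / 2) N
    have e : (1 / 2 : ℚ) + 1 = 3 / 2 := by norm_num
    rw [e] at h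
    have : (N : ℚ) + 1 ≠ 0 := by positivity
    rw [risingBinom_succ, poisedBasis_zero, oneFactor_zero, risingBinom_zero]
    simp only [Nat.choose_zero_right]
    push_cast
    rw [zero_add]
    field_simp
    linear_combination -8 * ((N : ℚ) + 1) * h
  | succ j ih =>
    have h := risingBinom_add_one_mul (j + 3 / 2) N
    have hc : ((N.choose (j + 1) : ℕ) : ℚ) * (j + 1) = N.choose j * (N - j) := by
      rcases le_or_gt j N with hj | hj
      · have := Nat.choose_succ_right_eq N j
        rw [← Nat.cast_sub hj]
        exact_mod_cast this
      · rw [Nat.choose_eq_zero_of_lt hj, Nat.choose_eq_zero_of_lt (by omega)]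
        simp
    have h1 := oneFactor_ne_zero add_one_sq_sub_zero_ne j
    have h2 : (2 * (j : ℚ) + 1) ≠ 0 := by positivity
    have h3 : (2 * (j : ℚ) + 3) ≠ 0 := by positivity
    have h4 : ((j : ℚ) + 1) ≠ 0 := by positivity
    have h5 : (2 * ((j : ℚ) + 1) + 1) ≠ 0 := by positivity
    have e : ((j + 1 : ℕ) : ℚ) + 3 / 2 = j + 3 / 2 + 1 := by push_cast; ring
    have eb : risingBinom (j + 3 / 2 + 1) N =
        risingBinom (j + 3 / 2) N * (j + 3 / 2 + N) / (j + 3 / 2) := by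
      rw [← h]; field_simp
    have ec : ((N.choose (j + 1) : ℕ) : ℚ) = N.choose j * (N - j) / (j + 1) := by
      rw [← hc]; field_simp
    rw [poisedBasis_succ, oneFactor_succ, risingBinom_succ (1 / 2) j, e, eb, ec, pow_succ (-1 : ℚ) j]
    have e2 : 4 * ((N + 1 : ℕ) - (j + 1 : ℕ) : ℚ) * risingBinom (1 / 2) (N + 1) *
        (poisedBasis j (N + 1 : ℕ) * ((j - (N + 1 : ℕ)) * ((N + 1 : ℕ) + 1 / 2 + j))) /
        ((2 * (j + 1 : ℕ) + 1) * (oneFactor 0 j * (((j : ℚ) + 1) ^ 2 - 0))) =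
      4 * ((N + 1 : ℕ) - j : ℚ) * risingBinom (1 / 2) (N + 1) * poisedBasis j (N + 1 : ℕ) /
        ((2 * j + 1) * oneFactor 0 j) *
      (-((N : ℚ) - j) * ((N + 1 : ℕ) + 1 / 2 + j) * (2 * j + 1) /
        ((2 * (j + 1) + 1) * (j + 1) ^ 2)) := by
      push_cast
      rw [sub_zero]
      field_simp
      ring
    rw [e2, ih]
    push_cast
    field_simp
    ring

/-- The truncated series `∑_{k < N} (4 k + 1) ((1/2)_k / k!) ^ 6`. -/
def sixthSum (N : ℕ) : ℚ :=
  ∑ k ∈ Finset.range N, (4 * (k : ℚ) + 1) * risingBinom (1 / 2) k ^ 6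

lemma sixthSum_eq (N : ℕ) :
    sixthSum (N + 1) = ((N + 1 : ℕ) * risingBinom (1 / 2) (N + 1)) *
      ∑ r ∈ Finset.range (N + 1), ∑ l ∈ Finset.range (N + 1),
        risingBinom (1 / 2) r ^ 3 * risingBinom (1 / 2) l *
        (2 * (-1) ^ (r + l) * (N.choose (r + l)) * risingBinom (1 / 2) (r + l) *
          risingBinom ((r + l : ℕ) + 3 / 2) N) := by
  have h1 : ∀ k ∈ Finset.range (N + 1), (4 * (k : ℚ) + 1) * risingBinom (1 / 2) k ^ 6 =
      ∑ r ∈ Finset.range (N + 1), ∑ l ∈ Finset.range (N + 1),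
        risingBinom (1 / 2) r ^ 3 * risingBinom (1 / 2) l / oneFactor 0 (r + l) *
        ((4 * (k : ℚ) + 1) * risingBinom (1 / 2) k ^ 2 * poisedBasis (r + l) k) := by
    intro k hk
    have : (4 * (k : ℚ) + 1) * risingBinom (1 / 2) k ^ 6 =
      (4 * (k : ℚ) + 1) * risingBinom (1 / 2) k ^ 2 * risingBinom (1 / 2) k ^ 4 := by ring
    rw [this, risingBinom_half_pow_four (Finset.mem_range.1 hk), Finset.mul_sum]
    refine Finset.sum_congr rfl fun r _ => ?_
    rw [Finset.mul_sum]
    refine Finset.sum_congr rfl fun l _ => ?_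
    ring
  rw [sixthSum, Finset.sum_congr rfl h1, Finset.sum_comm, Finset.mul_sum]
  refine Finset.sum_congr rfl fun r _ => ?_
  rw [Finset.sum_comm, Finset.mul_sum]
  refine Finset.sum_congr rfl fun l _ => ?_
  rw [← Finset.mul_sum, ← poisedBasis_eq_choose]
  have h2 := sum_poisedBasis (r + l) (N + 1)
  have h3 : (2 * ((r + l : ℕ) : ℚ) + 1) ≠ 0 := by positivity
  have h4 := oneFactor_ne_zero add_one_sq_sub_zero_ne (r + l)
  rw [mul_comm] at h2
  rw [eq_div_of_mul_eq h3 h2]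
  field_simp

/-- The truncated series is a `p`-integral multiple of `N ((1/2)_N / N!)`. -/
lemma sixthSum_eq_mul {p : ℕ} [Fact p.Prime] (hodd : Odd p) (N : ℕ) :
    ∃ c : ℚ, PDvd p 0 c ∧ sixthSum N = (N * risingBinom (1 / 2) N) * c := by
  cases N with
  | zero => exact ⟨0, PDvd.zero p 0, by simp [sixthSum]⟩
  | succ N =>
    refine ⟨_, ?_, sixthSum_eq N⟩
    refine PDvd.sum fun r _ => PDvd.sum fun l _ => ?_
    have ha := fun k => PDvd.risingBinom_half hodd k
    refine PDvd.mul_left (PDvd.mul_left (by simpa using (ha r).pow 3) (ha l)) ?_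
    refine PDvd.mul_left (PDvd.mul_left (PDvd.mul_left ?_ (PDvd.nat p _)) (ha _)) ?_
    · have := PDvd.int p (2 * (-1) ^ (r + l))
      push_cast at this
      exact this
    · have := PDvd.risingBinom_int_add_half hodd N ((r + l : ℕ) + 1 : ℤ)
      have e : (((r + l : ℕ) + 1 : ℤ) : ℚ) + 1 / 2 = ((r + l : ℕ) : ℚ) + 3 / 2 := by
        push_cast; ring
      rwa [e] at this

/-! ### Divisibility of the tail and of the half-range sum. -/

lemma risingBinom_half_reflect (N : ℕ) :
    risingBinom (1 / 2) N = (-1) ^ N * risingBinom (1 / 2 - N) N := by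
  induction N with
  | zero => simp [risingBinom]
  | succ N ih =>
    have h := risingBinom_add_one_mul (1 / 2 - (N + 1 : ℕ)) N
    have e : (1 / 2 : ℚ) - (N + 1 : ℕ) + 1 = 1 / 2 - N := by push_cast; ring
    have h1 : (N : ℚ) + 1 ≠ 0 := by positivity
    rw [e] at h
    rw [risingBinom_succ, risingBinom_succ, ih, pow_succ]
    push_cast at h ⊢
    generalize risingBinom (1 / 2 - (N + 1)) N = B at *
    generalize risingBinom (1 / 2 - N) N = A at *
    field_simp
    linear_combination -2 * h

lemma risingBinom_half_mul (j N : ℕ) :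
    risingBinom (1 / 2) j * risingBinom (1 / 2) N =
      (j + N).choose j * ((-1) ^ N * risingBinom (1 / 2 - N) (j + N)) := by
  induction j with
  | zero => simpa [risingBinom_zero] using risingBinom_half_reflect N
  | succ j ih =>
    have hc : (((j + N).choose j : ℕ) : ℚ) * (j + N + 1) =
        ((j + N + 1).choose (j + 1) : ℕ) * (j + 1) := by
      have := Nat.add_one_mul_choose_eq (j + N) j
      rw [mul_comm]
      exact_mod_cast this
    have h1 : (j : ℚ) + 1 ≠ 0 := by positivity
    have h2 : (j : ℚ) + N + 1 ≠ 0 := by positivity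
    rw [risingBinom_succ, mul_right_comm, ih, show j + 1 + N = j + N + 1 by ring,
      risingBinom_succ]
    have h3 : (((j + N + 1).choose (j + 1) : ℕ) : ℚ) =
        ((j + N).choose j : ℕ) * (j + N + 1) / (j + 1) := by
      rw [hc]; field_simp
    rw [h3]
    push_cast
    field_simp
    ring

/-- With j + N = p^s, the product a_j a_N contains the binomial coefficient of p^s over j, and N
times that coefficient is p^s times the one of p^s - 1 over j. -/
lemma PDvd.risingBinom_half_mul {p : ℕ} [Fact p.Prime] (hodd : Odd p) {s j : ℕ}
    (hj : j < p ^ s) :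
    PDvd p s (risingBinom (1 / 2) j *
      ((p ^ s - j : ℕ) * risingBinom (1 / 2) (p ^ s - j))) := by
  obtain ⟨N, hN⟩ := Nat.exists_eq_add_of_lt hj
  have hN' : p ^ s - j = N + 1 := by omega
  rw [hN']
  have hc : (((j + (N + 1)).choose j : ℕ) : ℚ) * (N + 1 : ℕ) =
      (p : ℚ) ^ s * ((j + N).choose j : ℕ) := by
    have h := Nat.add_one_mul_choose_eq (j + N) N
    have e : (j + (N + 1)).choose j = (j + N + 1).choose (N + 1) := Nat.choose_symm_add
    have e' : (j + N).choose j = (j + N).choose N := Nat.choose_symm_add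
    rw [e, e']
    have hN2 : (p : ℚ) ^ s = ((j + N + 1 : ℕ) : ℚ) := by rw [← hN]; push_cast; rfl
    rw [hN2]
    exact_mod_cast h.symm
  have h := _root_.risingBinom_half_mul j (N + 1)
  have : risingBinom (1 / 2) j * ((N + 1 : ℕ) * risingBinom (1 / 2) (N + 1)) =
      (p : ℚ) ^ s * ((j + N).choose j : ℕ) *
        ((-1) ^ (N + 1) * risingBinom (1 / 2 - (N + 1 : ℕ)) (j + (N + 1))) := by
    rw [← hc]
    linear_combination ((N + 1 : ℕ) : ℚ) * h
  rw [this]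
  refine ((PDvd.prime_pow p s).mul_right (PDvd.nat p _)).mul_right (PDvd.mul_left ?_ ?_)
  · have := PDvd.int p ((-1) ^ (N + 1))
    push_cast at this
    exact this
  · have := PDvd.risingBinom_int_add_half hodd (j + (N + 1)) (-(N + 1 : ℕ) : ℤ)
    have e : ((-(N + 1 : ℕ) : ℤ) : ℚ) + 1 / 2 = 1 / 2 - (N + 1 : ℕ) := by push_cast; ring
    rwa [e] at this

/-- Vandermonde with 2j = p^s + (2j - p^s): the term taking nothing from p^s vanishes since 2j - p^s
< j, and every other term has a binomial coefficient of p^s divisible by p. -/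
lemma dvd_centralBinom {p : ℕ} (hp : p.Prime) {s j : ℕ} (h1 : p ^ s < 2 * j) (h2 : j < p ^ s) :
    p ∣ Nat.centralBinom j := by
  obtain ⟨d, hd⟩ := Nat.exists_eq_add_of_lt h1
  rw [Nat.centralBinom, hd, add_assoc, Nat.add_choose_eq]
  refine Finset.dvd_sum fun x hx => ?_
  have hx' := Finset.HasAntidiagonal.mem_antidiagonal.1 hx
  rcases Nat.eq_zero_or_pos x.1 with h | h
  · rw [Nat.choose_eq_zero_of_lt (n := d + 1) (k := x.2) (by omega), mul_zero]
    exact dvd_zero p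
  · exact (hp.dvd_choose_pow h.ne' (by omega)).mul_right _

lemma PDvd.risingBinom_half_of_gt {p : ℕ} [Fact p.Prime] (hodd : Odd p) {s j : ℕ}
    (h1 : p ^ s < 2 * j) (h2 : j < p ^ s) : PDvd p 1 (risingBinom (1 / 2) j) := by
  rw [risingBinom_half_eq]
  have h : PDvd p 1 (Nat.centralBinom j : ℚ) := PDvd.pow_iff_dvd.2
    ((pow_one p).symm ▸ dvd_centralBinom Fact.out h1 h2)
  refine h.mul_right ?_
  have := PDvd.inv_two_pow (p := p) hodd (2 * j)
  rwa [pow_mul, show (2 : ℚ) ^ 2 = 4 by norm_num] at this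

lemma PDvd.tail_mul_sixthSum {p : ℕ} [Fact p.Prime] (hodd : Odd p) {s j : ℕ}
    (h1 : p ^ s < 2 * j) (h2 : j < p ^ s) :
    PDvd p (s + 5) ((4 * (j : ℚ) + 1) * risingBinom (1 / 2) j ^ 6 * sixthSum (p ^ s - j)) := by
  obtain ⟨c, hc, h⟩ := sixthSum_eq_mul (p := p) hodd (p ^ s - j)
  have e : (4 * (j : ℚ) + 1) * risingBinom (1 / 2) j ^ 6 * sixthSum (p ^ s - j) =
      (((4 * j + 1 : ℕ) : ℚ) * c) * ((risingBinom (1 / 2) j *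
      ((p ^ s - j : ℕ) * risingBinom (1 / 2) (p ^ s - j))) * risingBinom (1 / 2) j ^ 5) := by
    rw [h]; push_cast; ring
  rw [e]
  refine PDvd.mul_left (PDvd.mul_left (PDvd.nat p _) hc) ?_
  exact (PDvd.risingBinom_half_mul hodd h2).mul
    (by simpa using (PDvd.risingBinom_half_of_gt hodd h1 h2).pow 5)

lemma PDvd.sixthSum_middle {p : ℕ} [Fact p.Prime] (hodd : Odd p) {s M : ℕ}
    (hM : p ^ s = 2 * M + 1) : PDvd p s (sixthSum (M + 1)) := by
  obtain ⟨c, hc, h⟩ := sixthSum_eq_mul (p := p) hodd (M + 1)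
  have hM' : (p : ℚ) ^ s = 2 * M + 1 := by exact_mod_cast hM
  -- The factor p^s comes from 2(M + 1) a_{M+1} = (2M + 1) a_M.
  have e : 2 * sixthSum (M + 1) = (p : ℚ) ^ s * (risingBinom (1 / 2) M * c) := by
    have h1 : (M : ℚ) + 1 ≠ 0 := by positivity
    rw [h, risingBinom_succ, hM']
    push_cast
    field_simp
    ring
  refine PDvd.of_two_mul hodd ?_
  rw [e]
  exact (PDvd.prime_pow p s).mul_right ((PDvd.risingBinom_half hodd M).mul_left hc)

/-! ### Splitting the triangle. -/

/-- A triangular double sum is the square of the half-range sum plus two tails. -/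
lemma triangle_sum (f : ℕ → ℚ) (M : ℕ) :
    ∑ i ∈ Finset.range (2 * M + 1), ∑ j ∈ Finset.range (2 * M + 1),
      (if i + j < 2 * M + 1 then f i * f j else 0) =
    (∑ k ∈ Finset.range (M + 1), f k) ^ 2 +
      2 * ∑ j ∈ Finset.Ico (M + 1) (2 * M + 1), f j * ∑ i ∈ Finset.range (2 * M + 1 - j), f i := by
  have hsplit : ∀ g : ℕ → ℚ, ∑ i ∈ Finset.range (2 * M + 1), g i =
      ∑ i ∈ Finset.range (M + 1), g i + ∑ i ∈ Finset.Ico (M + 1) (2 * M + 1), g i := by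
    intro g
    rw [Finset.sum_range_add_sum_Ico _ (by omega)]
  have htail : ∀ j ∈ Finset.Ico (M + 1) (2 * M + 1),
      ∑ i ∈ Finset.range (M + 1), (if j + i < 2 * M + 1 then f j * f i else 0) =
        f j * ∑ i ∈ Finset.range (2 * M + 1 - j), f i := by
    intro j hj
    rw [Finset.mem_Ico] at hj
    rw [Finset.mul_sum, ← Finset.sum_filter]
    refine Finset.sum_congr ?_ fun _ _ => rfl
    ext i
    simp only [Finset.mem_filter, Finset.mem_range]
    omega
  have hsq : ∑ i ∈ Finset.range (M + 1), ∑ j ∈ Finset.range (M + 1),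
      (if i + j < 2 * M + 1 then f i * f j else 0) = (∑ k ∈ Finset.range (M + 1), f k) ^ 2 := by
    rw [sq, Finset.sum_mul_sum]
    refine Finset.sum_congr rfl fun i hi => Finset.sum_congr rfl fun j hj => ?_
    rw [Finset.mem_range] at hi hj
    rw [if_pos (by omega)]
  have hzero : ∀ i ∈ Finset.Ico (M + 1) (2 * M + 1), ∑ j ∈ Finset.Ico (M + 1) (2 * M + 1),
      (if i + j < 2 * M + 1 then f i * f j else 0) = 0 := by
    intro i hi
    refine Finset.sum_eq_zero fun j hj => ?_
    rw [Finset.mem_Ico] at hi hj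
    rw [if_neg (by omega)]
  have hswap : ∑ i ∈ Finset.range (M + 1), ∑ j ∈ Finset.Ico (M + 1) (2 * M + 1),
      (if i + j < 2 * M + 1 then f i * f j else 0) =
      ∑ j ∈ Finset.Ico (M + 1) (2 * M + 1), f j * ∑ i ∈ Finset.range (2 * M + 1 - j), f i := by
    rw [Finset.sum_comm, ← Finset.sum_congr rfl htail]
    refine Finset.sum_congr rfl fun j _ => Finset.sum_congr rfl fun i _ => ?_
    rw [add_comm i j, mul_comm (f i)]
  simp only [hsplit]
  rw [Finset.sum_add_distrib, Finset.sum_add_distrib, hsq, hswap, Finset.sum_congr rfl htail,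
    Finset.sum_congr rfl hzero]
  simp only [Finset.sum_const_zero]
  ring

/-! ### Whipple's transformation. -/

/-- Creative telescoping in `j`. The boundary term carries `halfFactor z K`, which disappears when z
= (K - 1/2)² with K ≥ 1. -/
lemma sum_poisedBasis_succ {z : ℚ} (hz : ∀ i : ℕ, ((i : ℚ) + 1) ^ 2 - z ≠ 0) (j K : ℕ) :
    (j + 1) * ∑ k ∈ Finset.range K, (4 * (k : ℚ) + 1) * risingBinom (1 / 2) k ^ 2 *
        (halfFactor z k / oneFactor z k) * poisedBasis (j + 1) k =
      (j + 1 / 2) * ((j + 1 / 2) ^ 2 - z) * (∑ k ∈ Finset.range K, (4 * (k : ℚ) + 1) *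
        risingBinom (1 / 2) k ^ 2 * (halfFactor z k / oneFactor z k) * poisedBasis j k) -
      2 * K * (K ^ 2 - z) * (K - j) * (risingBinom (1 / 2) K ^ 2 *
        (halfFactor z K / oneFactor z K) * poisedBasis j K) := by
  induction K with
  | zero => simp
  | succ K ih =>
    have h := poisedBasis_add_one j (K : ℚ)
    have h1 : (K : ℚ) + 1 ≠ 0 := by positivity
    have h2 : (K : ℚ) + 1 / 2 ≠ 0 := by positivity
    have h3 := oneFactor_ne_zero hz K
    have h4 := hz K
    have hG : ((K + 1 : ℕ) : ℚ) * (((K + 1 : ℕ) : ℚ) ^ 2 - z) * ((K + 1 : ℕ) - j) *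
        (risingBinom (1 / 2) (K + 1) ^ 2 * (halfFactor z (K + 1) / oneFactor z (K + 1)) *
          poisedBasis j (K + 1 : ℕ)) =
        (K + 1 / 2) * ((K + 1 / 2) ^ 2 - z) * (K + 1 / 2 + j) * (risingBinom (1 / 2) K ^ 2 *
          (halfFactor z K / oneFactor z K) * poisedBasis j K) := by
      rw [risingBinom_succ, halfFactor_succ, oneFactor_succ]
      push_cast
      have hp : poisedBasis j ((K : ℚ) + 1) * ((K : ℚ) + 1 - j) =
          poisedBasis j K * ((K + 1) * (K + 1 / 2 + j)) / (K + 1 / 2) := by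
        rw [← h]; field_simp
      calc _ = (poisedBasis j ((K : ℚ) + 1) * ((K : ℚ) + 1 - j)) *
            (((K : ℚ) + 1 / 2) ^ 2 / (K + 1) * ((K + 1 / 2) ^ 2 - z) *
              (risingBinom (1 / 2) K ^ 2 * (halfFactor z K / oneFactor z K))) := by
            field_simp
            ring
        _ = _ := by
            rw [hp]
            field_simp
    rw [Finset.sum_range_succ, mul_add, ih, Finset.sum_range_succ, poisedBasis_succ]
    linear_combination (2 : ℚ) * hG

lemma half_ne (M i : ℕ) : ((i : ℚ) + 1) ^ 2 - ((M : ℚ) + 1 / 2) ^ 2 ≠ 0 := by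
  intro h
  have h1 : ((i : ℚ) + 1 - (M + 1 / 2)) * (i + 1 + (M + 1 / 2)) = 0 := by
    linear_combination h
  rcases mul_eq_zero.1 h1 with h2 | h2
  · have h3 : (2 * i + 1 : ℚ) = 2 * M := by linear_combination 2 * h2
    have h4 : 2 * i + 1 = 2 * M := by exact_mod_cast h3
    omega
  · have : (0 : ℚ) < i + 1 + (M + 1 / 2) := by positivity
    exact this.ne' h2

/-- Reversing the product of i - M lets a_M turn it into the product of i + 1/2 - M; shifting the
other product by one step absorbs 4M + 1. Together they form the factors (i + 1)² - (M + 1/2)². -/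
lemma poisedBasis_self (M : ℕ) :
    (4 * (M : ℚ) + 1) * risingBinom (1 / 2) M * poisedBasis M M =
      (2 * M + 1) * oneFactor (((M : ℚ) + 1 / 2) ^ 2) M := by
  have e1 : ∏ i ∈ Finset.range M, ((i : ℚ) - M) = ∏ i ∈ Finset.range M, -((i : ℚ) + 1) := by
    rw [← Finset.prod_range_reflect]
    refine Finset.prod_congr rfl fun i hi => ?_
    rw [Finset.mem_range] at hi
    rw [Nat.sub_sub, Nat.cast_sub (by omega)]
    push_cast; ring
  have e2 : ∏ i ∈ Finset.range M, ((i : ℚ) + 1 / 2 - M) =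
      ∏ i ∈ Finset.range M, -((i : ℚ) + 1 / 2) := by
    rw [← Finset.prod_range_reflect]
    refine Finset.prod_congr rfl fun i hi => ?_
    rw [Finset.mem_range] at hi
    rw [Nat.sub_sub, Nat.cast_sub (by omega)]
    push_cast; ring
  have e3 : risingBinom (1 / 2) M * ∏ i ∈ Finset.range M, ((i : ℚ) - M) =
      ∏ i ∈ Finset.range M, ((i : ℚ) + 1 / 2 - M) := by
    rw [e1, e2, risingBinom, ← Finset.prod_mul_distrib]
    refine Finset.prod_congr rfl fun i _ => ?_
    have : (i : ℚ) + 1 ≠ 0 := by positivity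
    field_simp
    ring
  have e4 : (4 * (M : ℚ) + 1) * ∏ i ∈ Finset.range M, ((M : ℚ) + 1 / 2 + i) =
      (2 * M + 1) * ∏ i ∈ Finset.range M, ((i : ℚ) + 3 / 2 + M) := by
    have h1 := Finset.prod_range_succ (fun i : ℕ => (M : ℚ) + 1 / 2 + i) M
    rw [Finset.prod_range_succ'] at h1
    have h2 : ∏ i ∈ Finset.range M, ((M : ℚ) + 1 / 2 + (i + 1 : ℕ)) =
        ∏ i ∈ Finset.range M, ((i : ℚ) + 3 / 2 + M) :=
      Finset.prod_congr rfl fun i _ => by push_cast; ring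
    rw [h2] at h1
    push_cast at h1
    linear_combination -2 * h1
  have e5 : oneFactor (((M : ℚ) + 1 / 2) ^ 2) M =
      (∏ i ∈ Finset.range M, ((i : ℚ) + 1 / 2 - M)) *
        ∏ i ∈ Finset.range M, ((i : ℚ) + 3 / 2 + M) := by
    rw [oneFactor, ← Finset.prod_mul_distrib]
    exact Finset.prod_congr rfl fun i _ => by ring
  rw [e5, poisedBasis, Finset.prod_mul_distrib, ← e3]
  linear_combination (risingBinom (1 / 2) M * ∏ i ∈ Finset.range M, ((i : ℚ) - M)) * e4

lemma risingBinom_half_pos (k : ℕ) : 0 < risingBinom (1 / 2) k :=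
  Finset.prod_pos fun i _ => by positivity

/-- A terminating very-well-poised `₅F₄` summation. -/
lemma terminating_sum (M j : ℕ) :
    ∑ k ∈ Finset.range (M + 1), (4 * (k : ℚ) + 1) * risingBinom (1 / 2) k ^ 2 *
        (halfFactor (((M : ℚ) + 1 / 2) ^ 2) k / oneFactor (((M : ℚ) + 1 / 2) ^ 2) k) *
        poisedBasis j k =
      (2 * M + 1) * (risingBinom (1 / 2) j * halfFactor (((M : ℚ) + 1 / 2) ^ 2) j) := by
  set z := ((M : ℚ) + 1 / 2) ^ 2 with hz
  have hne := half_ne M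
  rw [← hz] at hne
  set V : ℕ → ℚ := fun j => ∑ k ∈ Finset.range (M + 1), (4 * (k : ℚ) + 1) *
    risingBinom (1 / 2) k ^ 2 * (halfFactor z k / oneFactor z k) * poisedBasis j k with hV
  have hrec : ∀ j, V j = V 0 * (risingBinom (1 / 2) j * halfFactor z j) := by
    intro j
    induction j with
    | zero => rw [risingBinom_zero, halfFactor_zero]; ring
    | succ j ih =>
      have h := sum_poisedBasis_succ hne j (M + 1)
      have h0 : halfFactor z (M + 1) = 0 := by rw [halfFactor_succ, hz, sub_self, mul_zero]
      rw [h0] at h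
      change (j + 1) * V (j + 1) = (j + 1 / 2) * ((j + 1 / 2) ^ 2 - z) * V j - _ at h
      rw [ih] at h
      have h1 : (j : ℚ) + 1 ≠ 0 := by positivity
      refine mul_left_cancel₀ h1 ?_
      rw [h, risingBinom_succ _ j, halfFactor_succ z j]
      field_simp
      ring
  -- The recurrence determines V up to V 0, which is recovered from the other end: at `j = M` only
  -- the term `k = M` survives.
  have hM : V M = (2 * M + 1) * (risingBinom (1 / 2) M * halfFactor z M) := by
    have h := poisedBasis_self M
    have h1 := oneFactor_ne_zero hne M
    rw [← hz] at h
    change ∑ k ∈ Finset.range (M + 1), _ = _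
    rw [Finset.sum_range_succ, Finset.sum_eq_zero, zero_add]
    · field_simp
      linear_combination risingBinom (1 / 2) M * halfFactor z M * h
    · intro k hk
      rw [poisedBasis_eq_zero (Finset.mem_range.1 hk), mul_zero]
  have h0 : risingBinom (1 / 2) M * halfFactor z M ≠ 0 := by
    refine mul_ne_zero (risingBinom_half_pos M).ne' (Finset.prod_ne_zero_iff.2 fun i hi => ?_)
    have hi' : (i : ℚ) < M := Nat.cast_lt.2 (Finset.mem_range.1 hi)
    have hi0 : (0 : ℚ) ≤ i := Nat.cast_nonneg i
    rw [hz]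
    have : ((i : ℚ) + 1 / 2) ^ 2 < ((M : ℚ) + 1 / 2) ^ 2 := by gcongr
    linarith
  have hV0 : V 0 = 2 * M + 1 := mul_right_cancel₀ h0 (by rw [← hrec, hM])
  change V j = _
  rw [hrec, hV0]

/-- A case of Whipple's transformation from `₇F₆` to `₄F₃`. -/
lemma whipple_sum (M : ℕ) {z : ℚ} (hz : ∀ i : ℕ, ((i : ℚ) + 1) ^ 2 - z ≠ 0) :
    ∑ k ∈ Finset.range (M + 1), (4 * (k : ℚ) + 1) * risingBinom (1 / 2) k ^ 2 *
        (halfFactor (((M : ℚ) + 1 / 2) ^ 2) k / oneFactor (((M : ℚ) + 1 / 2) ^ 2) k *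
          (halfFactor z k / oneFactor z k)) =
      (2 * M + 1) * ∑ j ∈ Finset.range (M + 1), risingBinom (1 / 2) j ^ 2 *
        (halfFactor (((M : ℚ) + 1 / 2) ^ 2) j / oneFactor z j) := by
  have h1 : ∀ k ∈ Finset.range (M + 1), (4 * (k : ℚ) + 1) * risingBinom (1 / 2) k ^ 2 *
      (halfFactor (((M : ℚ) + 1 / 2) ^ 2) k / oneFactor (((M : ℚ) + 1 / 2) ^ 2) k *
        (halfFactor z k / oneFactor z k)) =
      ∑ j ∈ Finset.range (M + 1), risingBinom (1 / 2) j / oneFactor z j *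
        ((4 * (k : ℚ) + 1) * risingBinom (1 / 2) k ^ 2 *
          (halfFactor (((M : ℚ) + 1 / 2) ^ 2) k / oneFactor (((M : ℚ) + 1 / 2) ^ 2) k) *
          poisedBasis j k) := by
    intro k hk
    have h := halfFactor_div_mul_poisedBasis hz (r := 0) (k := k) (L := M + 1)
      (by rw [Finset.mem_range] at hk; omega)
    rw [poisedBasis_zero, mul_one] at h
    rw [h, Finset.mul_sum, Finset.mul_sum]
    refine Finset.sum_congr rfl fun j _ => ?_
    rw [zero_add, halfFactor_zero]
    ring
  rw [Finset.sum_congr rfl h1, Finset.sum_comm, Finset.mul_sum]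
  refine Finset.sum_congr rfl fun j _ => ?_
  rw [← Finset.mul_sum, terminating_sum]
  ring

/-! ### First-order p-adic expansion of products. -/

/-- Linearization: every omitted term contains two small factors. The condition `1 ≤ e` makes each
denominator a p-adic unit. -/
lemma PDvd.prod_div_sub {p e : ℕ} [Fact p.Prime] (he : 1 ≤ e) {f g : ℕ → ℚ} (j : ℕ)
    (hf : ∀ i < j, PDvd p e (f i)) (hg : ∀ i < j, PDvd p e (g i)) :
    PDvd p (2 * e) (∏ i ∈ Finset.range j, (1 - f i) / (1 + g i) -
      (1 - ∑ i ∈ Finset.range j, (f i + g i))) := by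
  induction j with
  | zero => simpa using PDvd.zero p (2 * e)
  | succ j ih =>
    have h := ih (fun i hi => hf i (by omega)) (fun i hi => hg i (by omega))
    have hS : PDvd p e (∑ i ∈ Finset.range j, (f i + g i)) := PDvd.sum fun i hi =>
      (hf i (by rw [Finset.mem_range] at hi; omega)).add
        (hg i (by rw [Finset.mem_range] at hi; omega))
    have hfj := hf j (by omega)
    have hgj := hg j (by omega)
    have hinv := PDvd.inv_one_add (hgj.mono he)
    have hne : 1 + g j ≠ 0 := by
      intro h0
      have h1 : g j = -1 := by linear_combination h0
      have h2 := hgj.mono he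
      rw [h1] at h2
      have h3 : PDvd p 1 ((1 : ℕ) : ℚ) := by simpa using h2.neg
      rw [PDvd.pow_iff_dvd, pow_one] at h3
      exact (Fact.out : p.Prime).one_lt.ne' (Nat.dvd_one.1 h3)
    rw [Finset.prod_range_succ, Finset.sum_range_succ]
    set P := ∏ i ∈ Finset.range j, (1 - f i) / (1 + g i)
    set S := ∑ i ∈ Finset.range j, (f i + g i)
    have e1 : P * ((1 - f j) / (1 + g j)) - (1 - (S + (f j + g j))) =
        (P - (1 - S)) * ((1 - f j) * (1 + g j)⁻¹) +
          (f j + g j) * (g j + S) * (1 + g j)⁻¹ := by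
      field_simp
      ring
    rw [e1]
    refine (h.mul_right ((PDvd.sub (PDvd.one p) hfj.integral).mul_left hinv)).add ?_
    rw [two_mul]
    exact ((hfj.add hgj).mul (hgj.add hS)).mul_right hinv

/-! ### Reflection symmetry modulo p and p^5. -/

/-- Alternating sums of `n ^ 4 / j ^ 4`. -/
def altFourth (n : ℚ) (m : ℕ) : ℚ :=
  ∑ j ∈ Finset.range m, (-1) ^ j * (n / (j + 1 : ℕ)) ^ 4

lemma altFourth_two_mul (n : ℚ) (k : ℕ) :
    altFourth n (2 * k) = ∑ i ∈ Finset.range k,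
      ((n / (2 * i + 1 : ℕ)) ^ 4 + -(n / (2 * i + 2 : ℕ)) ^ 4) := by
  induction k with
  | zero => simp [altFourth]
  | succ k ih =>
    rw [Finset.sum_range_succ, ← ih, altFourth, altFourth, show 2 * (k + 1) = 2 * k + 1 + 1 by ring,
      Finset.sum_range_succ, Finset.sum_range_succ, pow_succ (-1 : ℚ) (2 * k),
      Even.neg_one_pow ⟨k, two_mul k⟩]
    ring

lemma sum_sq_eq_harmonicTwo (n : ℚ) (k : ℕ) :
    ∑ i ∈ Finset.range k, ((n / (2 * i + 1 : ℕ)) ^ 2 + (n / (2 * i + 2 : ℕ)) ^ 2) =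
      n ^ 2 * harmonicTwo (2 * k) := by
  induction k with
  | zero => simp [harmonicTwo]
  | succ k ih =>
    rw [Finset.sum_range_succ, ih, harmonicTwo, harmonicTwo,
      show 2 * (k + 1) = 2 * k + 1 + 1 by ring, Finset.sum_Icc_succ_top (by omega),
      Finset.sum_Icc_succ_top (by omega),
      div_pow, div_pow]
    push_cast
    ring

lemma choose_half_eq {M : ℕ} {n : ℚ} (hn : n = 2 * M + 1) (k : ℕ) :
    (-1) ^ k * (M.choose k : ℚ) = risingBinom (1 / 2) k *
      ∏ i ∈ Finset.range k, (1 - n / (2 * i + 1 : ℕ)) := by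
  induction k with
  | zero => simp [risingBinom]
  | succ k ih =>
    have hc : ((M.choose (k + 1) : ℕ) : ℚ) * (k + 1) = M.choose k * (M - k) := by
      rcases le_or_gt k M with hj | hj
      · have := Nat.choose_succ_right_eq M k
        rw [← Nat.cast_sub hj]
        exact_mod_cast this
      · rw [Nat.choose_eq_zero_of_lt hj, Nat.choose_eq_zero_of_lt (by omega)]
        simp
    have h1 : (k : ℚ) + 1 ≠ 0 := by positivity
    have h2 : 2 * (k : ℚ) + 1 ≠ 0 := by positivity
    have e : (-1) ^ (k + 1) * ((M.choose (k + 1) : ℕ) : ℚ) =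
        ((-1) ^ k * (M.choose k : ℚ)) * (-(M - k) / (k + 1)) := by
      rw [pow_succ]
      field_simp
      linear_combination -hc
    rw [e, ih, Finset.prod_range_succ, risingBinom_succ, hn]
    push_cast
    field_simp
    ring

lemma PDvd.sign_mul {p m : ℕ} {x : ℚ} (j : ℕ) (h : PDvd p m x) : PDvd p m ((-1) ^ j * x) := by
  rcases neg_one_pow_eq_or ℚ j with h1 | h1 <;> rw [h1]
  · simpa using h
  · simpa using h.neg

section

variable {p s M : ℕ} [Fact p.Prime]

/-- With u = n/j, n/(n - j) = -u/(1 - u); the even power removes the sign, and the remaining error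
is divisible by u^5. -/
lemma PDvd.div_fourth_reflect (hM : p ^ s = 2 * M + 1) {j : ℕ} (hj : j < 2 * M) :
    PDvd p 5 (((p : ℚ) ^ s / (2 * M - 1 - j + 1 : ℕ)) ^ 4 - ((p : ℚ) ^ s / (j + 1 : ℕ)) ^ 4) := by
  have hn : (p : ℚ) ^ s = 2 * M + 1 := by exact_mod_cast hM
  have hu : PDvd p 1 ((p : ℚ) ^ s / (j + 1 : ℕ)) := PDvd.prime_pow_div (by omega) (by omega)
  have hinv := PDvd.inv_one_add hu.neg
  set u := (p : ℚ) ^ s / (j + 1 : ℕ) with hu'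
  have hj1 : ((j + 1 : ℕ) : ℚ) ≠ 0 := by positivity
  have e : ((2 * M - 1 - j + 1 : ℕ) : ℚ) = (p : ℚ) ^ s - (j + 1 : ℕ) := by
    rw [hn]
    have : 2 * M - 1 - j + 1 = 2 * M - j := by omega
    rw [this, Nat.cast_sub (by omega)]
    push_cast; ring
  have hne : (p : ℚ) ^ s - (j + 1 : ℕ) ≠ 0 := by
    rw [← e]; positivity
  have hne1 : 1 + -u ≠ 0 := by
    intro h
    apply hne
    have : (p : ℚ) ^ s = u * (j + 1 : ℕ) := by rw [hu']; field_simp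
    rw [this]
    linear_combination -((j + 1 : ℕ) : ℚ) * h
  have e2 : (p : ℚ) ^ s / (2 * M - 1 - j + 1 : ℕ) = -u * (1 + -u)⁻¹ := by
    have h : (p : ℚ) ^ s = u * (j + 1 : ℕ) := by rw [hu']; field_simp
    rw [e]
    rw [eq_mul_inv_iff_mul_eq₀ hne1, div_mul_eq_mul_div, div_eq_iff hne]
    rw [h]
    ring
  have e3 : (-u * (1 + -u)⁻¹) ^ 4 - u ^ 4 =
      u ^ 4 * u * ((4 - 6 * u + 4 * u ^ 2 - u ^ 3) * ((1 + -u)⁻¹) ^ 4) := by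
    field_simp
    ring
  rw [e2, e3]
  have hu0 := hu.integral
  refine PDvd.mul_right ?_ (PDvd.mul_left ?_ (by simpa using hinv.pow 4))
  · simpa using (hu.pow 4).mul hu
  · have h4 : PDvd p 0 (4 : ℚ) := by simpa using PDvd.nat p 4
    have h6 : PDvd p 0 (6 : ℚ) := by simpa using PDvd.nat p 6
    exact ((h4.sub (h6.mul_left hu0)).add (h4.mul_left (by simpa using hu0.pow 2))).sub
      (by simpa using hu0.pow 3)

lemma PDvd.altFourth_add (hM : p ^ s = 2 * M + 1) {m l : ℕ} (h : m + l = 2 * M) :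
    PDvd p 5 (altFourth ((p : ℚ) ^ s) (2 * M) - altFourth ((p : ℚ) ^ s) m +
      altFourth ((p : ℚ) ^ s) l) := by
  have e : altFourth ((p : ℚ) ^ s) (2 * M) - altFourth ((p : ℚ) ^ s) m +
      altFourth ((p : ℚ) ^ s) l = ∑ i ∈ Finset.range l, -((-1) ^ i *
        (((p : ℚ) ^ s / (2 * M - 1 - i + 1 : ℕ)) ^ 4 - ((p : ℚ) ^ s / (i + 1 : ℕ)) ^ 4)) := by
    rw [altFourth, altFourth, altFourth, ← h, Finset.sum_range_add, add_sub_cancel_left,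
      ← Finset.sum_range_reflect (fun x => (-1 : ℚ) ^ (m + x) * _) l, ← Finset.sum_add_distrib]
    refine Finset.sum_congr rfl fun i hi => ?_
    rw [Finset.mem_range] at hi
    have h1 : m + (l - 1 - i) = m + l - 1 - i := by omega
    -- Since `m + l = 2 * M` is even, reflecting the index reverses the alternating sign.
    have h2 : (-1 : ℚ) ^ (m + l - 1 - i) = -(-1) ^ i := by
      have h3 : (-1 : ℚ) ^ (m + l - 1 - i) * (-1) ^ (i + 1) = 1 := by
        rw [← pow_add, show m + l - 1 - i + (i + 1) = 2 * M by omega, pow_mul]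
        norm_num
      rcases neg_one_pow_eq_or ℚ i with h4 | h4 <;> rw [pow_succ, h4] at h3 <;> rw [h4] <;>
        linarith
    rw [h1, h2]
    ring
  rw [e]
  refine PDvd.sum fun i hi => (PDvd.sign_mul i (PDvd.div_fourth_reflect hM ?_)).neg
  rw [Finset.mem_range] at hi
  omega

lemma PDvd.altFourth_sub (hodd : Odd p) (hM : p ^ s = 2 * M + 1) {m l : ℕ} (h : m + l = 2 * M) :
    PDvd p 5 (altFourth ((p : ℚ) ^ s) l - altFourth ((p : ℚ) ^ s) m) := by
  have h0 := PDvd.altFourth_add hM (zero_add (2 * M))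
  have h1 := PDvd.altFourth_add hM h
  -- Taking `m = 0` in the reflection doubles the full alternating sum, which therefore vanishes
  -- modulo p^5.
  have h2 : PDvd p 5 (altFourth ((p : ℚ) ^ s) (2 * M)) := by
    refine PDvd.of_two_mul hodd ?_
    have e : altFourth ((p : ℚ) ^ s) 0 = 0 := by simp [altFourth]
    rw [e, sub_zero, ← two_mul] at h0
    exact h0
  have e : altFourth ((p : ℚ) ^ s) l - altFourth ((p : ℚ) ^ s) m =
    (altFourth ((p : ℚ) ^ s) (2 * M) - altFourth ((p : ℚ) ^ s) m +
      altFourth ((p : ℚ) ^ s) l) - altFourth ((p : ℚ) ^ s) (2 * M) := by ring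
  rw [e]
  exact h1.sub h2

lemma PDvd.altFourth (hM : p ^ s = 2 * M + 1) {m : ℕ} (h : m ≤ 2 * M) :
    PDvd p 4 (altFourth ((p : ℚ) ^ s) m) := by
  refine PDvd.sum fun i hi => PDvd.sign_mul i ?_
  rw [Finset.mem_range] at hi
  simpa using (PDvd.prime_pow_div (p := p) (s := s) (j := i + 1) (by omega) (by omega)).pow 4

lemma PDvd.risingBinom_sq_sub_choose (hodd : Odd p) (hM : p ^ s = 2 * M + 1) {k : ℕ}
    (hk : k ≤ M) : PDvd p 1 (risingBinom (1 / 2) k ^ 2 - (M.choose k : ℚ) ^ 2) := by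
  have hP : PDvd p 1 (∏ i ∈ Finset.range k, (1 - (p : ℚ) ^ s / (2 * i + 1 : ℕ)) - 1) := by
    have hd : ∀ i < k, PDvd p 1 ((p : ℚ) ^ s / (2 * i + 1 : ℕ)) := fun i hi =>
      PDvd.prime_pow_div (by omega) (by omega)
    have h := PDvd.prod_div_sub le_rfl k hd (g := fun _ => 0) (fun _ _ => PDvd.zero p 1)
    simp only [add_zero, div_one] at h
    have h2 := PDvd.sum (s := Finset.range k) fun i hi => hd i (Finset.mem_range.1 hi)
    have := (h.mono (show 1 ≤ 2 * 1 by norm_num)).sub h2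
    refine (congrArg (PDvd p 1) ?_).mp this
    ring
  have hc := choose_half_eq (M := M) (n := (p : ℚ) ^ s) (by exact_mod_cast hM) k
  set P := ∏ i ∈ Finset.range k, (1 - (p : ℚ) ^ s / (2 * i + 1 : ℕ))
  have hsq : (M.choose k : ℚ) ^ 2 = risingBinom (1 / 2) k ^ 2 * P ^ 2 := by
    rw [← mul_pow, ← hc, mul_pow, ← pow_mul, mul_comm k, pow_mul]
    norm_num
  have e : risingBinom (1 / 2) k ^ 2 - (M.choose k : ℚ) ^ 2 =
      -(risingBinom (1 / 2) k ^ 2 * ((P - 1) * (P - 1 + 2))) := by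
    rw [hsq]; ring
  rw [e]
  have ha := (PDvd.risingBinom_half hodd k).pow 2
  rw [zero_mul] at ha
  have h2 : PDvd p 0 (2 : ℚ) := by simpa using PDvd.nat p 2
  exact (ha.mul_left (hP.mul_right (hP.integral.add h2))).neg

/-- Modulo p, a_k² is the square of the binomial coefficient of M over k, which is symmetric under k
↦ M - k. -/
lemma PDvd.risingBinom_pow_six_reflect (hodd : Odd p) (hM : p ^ s = 2 * M + 1) {k : ℕ}
    (hk : k ≤ M) :
    PDvd p 1 (risingBinom (1 / 2) (M - k) ^ 6 - risingBinom (1 / 2) k ^ 6) := by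
  have h1 := PDvd.risingBinom_sq_sub_choose hodd hM hk
  have h2 := PDvd.risingBinom_sq_sub_choose hodd hM (Nat.sub_le M k)
  rw [Nat.choose_symm hk] at h2
  have ha := fun k => (PDvd.risingBinom_half (p := p) hodd k)
  have ha2 : ∀ k, PDvd p 0 (risingBinom (1 / 2) k ^ 2) := fun k => by simpa using (ha k).pow 2
  have e : risingBinom (1 / 2) (M - k) ^ 6 - risingBinom (1 / 2) k ^ 6 =
      ((risingBinom (1 / 2) (M - k) ^ 2 - (M.choose k : ℚ) ^ 2) -
        (risingBinom (1 / 2) k ^ 2 - (M.choose k : ℚ) ^ 2)) *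
      (risingBinom (1 / 2) (M - k) ^ 2 * risingBinom (1 / 2) (M - k) ^ 2 +
        risingBinom (1 / 2) (M - k) ^ 2 * risingBinom (1 / 2) k ^ 2 +
        risingBinom (1 / 2) k ^ 2 * risingBinom (1 / 2) k ^ 2) := by ring
  rw [e]
  exact (h2.sub h1).mul_right ((((ha2 _).mul_left (ha2 _)).add ((ha2 _).mul_left (ha2 _))).add
    ((ha2 _).mul_left (ha2 _)))

/-- The reflection `k ↦ M - k` kills the weighted sums modulo `p ^ 5`. -/
lemma PDvd.sum_mul_altFourth (hs : 1 ≤ s) (hodd : Odd p) (hM : p ^ s = 2 * M + 1) :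
    PDvd p 5 (∑ k ∈ Finset.range (M + 1), (4 * (k : ℚ) + 1) * risingBinom (1 / 2) k ^ 6 *
      _root_.altFourth ((p : ℚ) ^ s) (2 * k)) := by
  have hn : (p : ℚ) ^ s = 2 * M + 1 := by exact_mod_cast hM
  have hn1 : PDvd p 1 ((p : ℚ) ^ s) := (PDvd.prime_pow p s).mono hs
  refine PDvd.of_two_mul hodd ?_
  rw [two_mul]
  nth_rewrite 1 [← Finset.sum_range_reflect]
  rw [← Finset.sum_add_distrib]
  refine PDvd.sum fun k hk => ?_
  rw [Finset.mem_range] at hk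
  have hk' : k ≤ M := by omega
  rw [show M + 1 - 1 - k = M - k by omega]
  have h6 := PDvd.risingBinom_pow_six_reflect hodd hM hk'
  have ht := PDvd.altFourth_sub hodd hM (m := 2 * k) (l := 2 * (M - k)) (by omega)
  have ht1 := PDvd.altFourth (p := p) hM (m := 2 * k) (by omega)
  have ht2 := PDvd.altFourth (p := p) hM (m := 2 * (M - k)) (by omega)
  have ha : ∀ k, PDvd p 0 (risingBinom (1 / 2) k ^ 6) := fun k => by
    simpa using (PDvd.risingBinom_half (p := p) hodd k).pow 6
  have hk4 : PDvd p 0 (4 * (k : ℚ) + 1) := by simpa using PDvd.nat p (4 * k + 1)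
  have h2 : PDvd p 0 (2 : ℚ) := by simpa using PDvd.nat p 2
  rw [Nat.cast_sub hk']
  set t1 := _root_.altFourth ((p : ℚ) ^ s) (2 * k)
  set t2 := _root_.altFourth ((p : ℚ) ^ s) (2 * (M - k))
  set a1 := risingBinom (1 / 2) k ^ 6
  set a2 := risingBinom (1 / 2) (M - k) ^ 6
  -- The weight is antisymmetric up to 2n: 4(M - k) + 1 = 2n - (4k + 1). The other factors are
  -- symmetric to the required precision because `t2` is already divisible by p^4.
  have e : (4 * ((M : ℚ) - k) + 1) * a2 * t2 + (4 * (k : ℚ) + 1) * a1 * t1 =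
      2 * ((p : ℚ) ^ s * t2 * a2) - (4 * (k : ℚ) + 1) * (((a2 - a1) * t2) + a1 * (t2 - t1)) := by
    rw [hn]; ring
  rw [e]
  refine (h2.mul_left ((hn1.mul ht2).mul_right (ha _))).sub (hk4.mul_left (PDvd.add ?_ ?_))
  · exact h6.mul ht2
  · exact (ha k).mul_left ht

end

/-! ### The half-range sum modulo p^5. -/

lemma halfFactor_div_eq {n : ℚ} (j : ℕ) :
    risingBinom (1 / 2) j ^ 2 * (halfFactor (n ^ 2 / 4) j / oneFactor (-(n ^ 2 / 4)) j) =
      risingBinom (1 / 2) j ^ 4 * ∏ i ∈ Finset.range j,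
        (1 - (n / (2 * i + 1 : ℕ)) ^ 2) / (1 + (n / (2 * i + 2 : ℕ)) ^ 2) := by
  have e : risingBinom (1 / 2) j ^ 4 = risingBinom (1 / 2) j ^ 2 * risingBinom (1 / 2) j ^ 2 := by
    ring
  rw [e, mul_assoc]
  congr 1
  rw [halfFactor, oneFactor, ← Finset.prod_div_distrib, risingBinom, ← Finset.prod_pow,
    ← Finset.prod_mul_distrib]
  refine Finset.prod_congr rfl fun i _ => ?_
  have h1 : (i : ℚ) + 1 ≠ 0 := by positivity
  have h2 : 2 * (i : ℚ) + 1 ≠ 0 := by positivity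
  have h3 : ((i : ℚ) + 1) ^ 2 - -(n ^ 2 / 4) ≠ 0 := by
    rw [sub_neg_eq_add]; positivity
  have h4 : 1 + (n / (2 * i + 2 : ℕ)) ^ 2 ≠ 0 := by positivity
  rw [← mul_div_assoc, div_eq_div_iff h3 h4]
  push_cast
  have h5 : 2 * (i : ℚ) + 2 ≠ 0 := by positivity
  field_simp
  ring

lemma halfFactor_mul_div_eq {M : ℕ} {n : ℚ} (hM : n = 2 * M + 1) (k : ℕ) :
    risingBinom (1 / 2) k ^ 2 * (halfFactor (n ^ 2 / 4) k /
        oneFactor (n ^ 2 / 4) k * (halfFactor (-(n ^ 2 / 4)) k /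
          oneFactor (-(n ^ 2 / 4)) k)) =
      risingBinom (1 / 2) k ^ 6 * ∏ i ∈ Finset.range k,
        (1 - (n / (2 * i + 1 : ℕ)) ^ 4) /
          (1 + -(n / (2 * i + 2 : ℕ)) ^ 4) := by
  have e : risingBinom (1 / 2) k ^ 6 = risingBinom (1 / 2) k ^ 2 * risingBinom (1 / 2) k ^ 4 := by
    ring
  rw [e, mul_assoc]
  congr 1
  rw [halfFactor, oneFactor, halfFactor, oneFactor, ← Finset.prod_div_distrib,
    ← Finset.prod_div_distrib, ← Finset.prod_mul_distrib, risingBinom, ← Finset.prod_pow,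
    ← Finset.prod_mul_distrib]
  refine Finset.prod_congr rfl fun i _ => ?_
  have h1 : (i : ℚ) + 1 ≠ 0 := by positivity
  have h2 : 2 * (i : ℚ) + 1 ≠ 0 := by positivity
  have h3 : ((i : ℚ) + 1) ^ 2 - -(n ^ 2 / 4) ≠ 0 := by
    rw [sub_neg_eq_add]; positivity
  have h4 : ((i : ℚ) + 1) ^ 2 - n ^ 2 / 4 ≠ 0 := by
    have := half_ne M i
    rw [hM]
    convert this using 2
    ring
  have h5 : 2 * (i : ℚ) + 2 ≠ 0 := by positivity
  have h6 : 1 + -(n / (2 * i + 2 : ℕ)) ^ 4 ≠ 0 := by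
    have e6 : 1 + -(n / (2 * i + 2 : ℕ)) ^ 4 =
        (((i : ℚ) + 1) ^ 2 - -(n ^ 2 / 4)) * (((i : ℚ) + 1) ^ 2 - n ^ 2 / 4) / (i + 1) ^ 4 := by
      push_cast
      field_simp
      ring
    rw [e6]
    positivity
  rw [div_mul_div_comm, ← mul_div_assoc, div_eq_div_iff (mul_ne_zero h4 h3) h6]
  push_cast
  field_simp
  ring

section

variable {p s M : ℕ} [Fact p.Prime]

lemma PDvd.prod_sub_harmonic (hM : p ^ s = 2 * M + 1) {j : ℕ} (hj : j ≤ M) :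
    PDvd p 4 (∏ i ∈ Finset.range j, (1 - ((p : ℚ) ^ s / (2 * i + 1 : ℕ)) ^ 2) /
      (1 + ((p : ℚ) ^ s / (2 * i + 2 : ℕ)) ^ 2) -
        (1 - ((p : ℚ) ^ s) ^ 2 * harmonicTwo (2 * j))) := by
  rw [← sum_sq_eq_harmonicTwo]
  exact PDvd.prod_div_sub (e := 2) (by norm_num) j
    (fun i hi => by simpa using (PDvd.prime_pow_div (p := p) (s := s) (j := 2 * i + 1)
      (by omega) (by omega)).pow 2)
    (fun i hi => by simpa using (PDvd.prime_pow_div (p := p) (s := s) (j := 2 * i + 2)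
      (by omega) (by omega)).pow 2)

lemma PDvd.prod_sub_altFourth (hM : p ^ s = 2 * M + 1) {j : ℕ} (hj : j ≤ M) :
    PDvd p 5 (∏ i ∈ Finset.range j, (1 - ((p : ℚ) ^ s / (2 * i + 1 : ℕ)) ^ 4) /
      (1 + -((p : ℚ) ^ s / (2 * i + 2 : ℕ)) ^ 4) -
        (1 - _root_.altFourth ((p : ℚ) ^ s) (2 * j))) := by
  rw [altFourth_two_mul]
  exact (PDvd.prod_div_sub (e := 4) (by norm_num) j
    (fun i hi => by simpa using (PDvd.prime_pow_div (p := p) (s := s) (j := 2 * i + 1)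
      (by omega) (by omega)).pow 4)
    (fun i hi => by simpa using ((PDvd.prime_pow_div (p := p) (s := s) (j := 2 * i + 2)
      (by omega) (by omega)).pow 4).neg)).mono (by norm_num)

lemma PDvd.harmonicTwo (hM : p ^ s = 2 * M + 1) {j : ℕ} (hj : j ≤ M) :
    PDvd p 2 (((p : ℚ) ^ s) ^ 2 * harmonicTwo (2 * j)) := by
  rw [← sum_sq_eq_harmonicTwo]
  refine PDvd.sum fun i hi => ?_
  rw [Finset.mem_range] at hi
  exact PDvd.add
    (by simpa using (PDvd.prime_pow_div (p := p) (s := s) (j := 2 * i + 1)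
      (by omega) (by omega)).pow 2)
    (by simpa using (PDvd.prime_pow_div (p := p) (s := s) (j := 2 * i + 2)
      (by omega) (by omega)).pow 2)

/-- The half-range sixth power sum modulo `p ^ 5`. -/
lemma PDvd.sixthSum_sub (hs : 1 ≤ s) (hodd : Odd p) (hM : p ^ s = 2 * M + 1) :
    PDvd p 5 (sixthSum (M + 1) - (p : ℚ) ^ s * ∑ j ∈ Finset.range (M + 1),
      risingBinom (1 / 2) j ^ 4 * (1 - ((p : ℚ) ^ s) ^ 2 * _root_.harmonicTwo (2 * j))) := by
  have hn : (p : ℚ) ^ s = 2 * M + 1 := by exact_mod_cast hM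
  have hn1 : PDvd p 1 ((p : ℚ) ^ s) := (PDvd.prime_pow p s).mono hs
  have ha := fun k => PDvd.risingBinom_half (p := p) hodd k
  -- Choosing z opposite to (M + 1/2)² = n²/4 cancels the quadratic terms on the left and combines
  -- the odd and even reciprocal squares into H_{2j}^{(2)} on the right.
  have hw := whipple_sum M (z := -(((p : ℚ) ^ s) ^ 2 / 4)) (fun i => by
    rw [sub_neg_eq_add]; positivity)
  have hz : ((M : ℚ) + 1 / 2) ^ 2 = ((p : ℚ) ^ s) ^ 2 / 4 := by rw [hn]; ring
  rw [hz, ← hn] at hw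
  have e1 := Finset.sum_congr (s₁ := Finset.range (M + 1)) rfl
    fun k _ => halfFactor_div_eq (n := (p : ℚ) ^ s) k
  rw [e1] at hw
  simp only [mul_assoc (4 * (_ : ℚ) + 1), halfFactor_mul_div_eq hn] at hw
  have hL : PDvd p 5 (∑ k ∈ Finset.range (M + 1), (4 * (k : ℚ) + 1) * (risingBinom (1 / 2) k ^ 6 *
      (∏ i ∈ Finset.range k, (1 - ((p : ℚ) ^ s / (2 * i + 1 : ℕ)) ^ 4) /
        (1 + -((p : ℚ) ^ s / (2 * i + 2 : ℕ)) ^ 4) -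
        (1 - _root_.altFourth ((p : ℚ) ^ s) (2 * k))))) := by
    refine PDvd.sum fun k hk => PDvd.mul_left ?_ (PDvd.mul_left ?_ (PDvd.prod_sub_altFourth hM ?_))
    · simpa using PDvd.nat p (4 * k + 1)
    · simpa using (ha k).pow 6
    · rw [Finset.mem_range] at hk; omega
  have hR : PDvd p 5 ((p : ℚ) ^ s * ∑ j ∈ Finset.range (M + 1), risingBinom (1 / 2) j ^ 4 *
      (∏ i ∈ Finset.range j, (1 - ((p : ℚ) ^ s / (2 * i + 1 : ℕ)) ^ 2) /
        (1 + ((p : ℚ) ^ s / (2 * i + 2 : ℕ)) ^ 2) -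
        (1 - ((p : ℚ) ^ s) ^ 2 * _root_.harmonicTwo (2 * j)))) := by
    refine hn1.mul (l := 4) (PDvd.sum fun j hj => PDvd.mul_left ?_ (PDvd.prod_sub_harmonic hM ?_))
    · simpa using (ha j).pow 4
    · rw [Finset.mem_range] at hj; omega
  have hA := PDvd.sum_mul_altFourth hs hodd hM
  refine (congrArg (PDvd p 5) ?_).mp ((hR.sub hL).add hA)
  simp only [mul_sub, Finset.sum_sub_distrib, sixthSum, mul_one] at hw ⊢
  simp only [mul_assoc] at hw ⊢
  rw [hw]
  ring

end

/-! ### Assembly of the congruence. -/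

lemma shiftedFactorial_div (k : ℕ) :
    shiftedFactorial (1 / 2) k / shiftedFactorial 1 k = risingBinom (1 / 2) k := by
  induction k with
  | zero => simp [shiftedFactorial, risingBinom]
  | succ k ih =>
    rw [risingBinom_succ, ← ih]
    simp only [shiftedFactorial, ascPochhammer_succ_eval]
    rw [mul_div_mul_comm, add_comm (1 : ℚ)]

theorem mainTheorem8 (p : ℕ) (hp : p.Prime) (hodd : Odd p) (s : ℕ) (hs : 1 ≤ s) :
    RatCongrModPow p (s + 5)
      (∑ ij ∈ (Finset.range (p ^ s) ×ˢ Finset.range (p ^ s)).filter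
          (fun ij : ℕ × ℕ => ij.1 + ij.2 ≤ p ^ s - 1),
        (4 * (ij.1 : ℚ) + 1) * (4 * (ij.2 : ℚ) + 1) *
          ((shiftedFactorial (1 / 2) ij.1 ^ 6 * shiftedFactorial (1 / 2) ij.2 ^ 6) /
            (shiftedFactorial 1 ij.1 ^ 6 * shiftedFactorial 1 ij.2 ^ 6)))
      ((p : ℚ) ^ (2 * s) *
        (∑ k ∈ Finset.range ((p ^ s - 1) / 2 + 1),
          shiftedFactorial (1 / 2) k ^ 4 / shiftedFactorial 1 k ^ 4) *
        (∑ k ∈ Finset.range ((p ^ s - 1) / 2 + 1),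
          shiftedFactorial (1 / 2) k ^ 4 / shiftedFactorial 1 k ^ 4 *
            (1 - 2 * (p : ℚ) ^ (2 * s) * harmonicTwo (2 * k)))) := by
  have : Fact p.Prime := ⟨hp⟩
  obtain ⟨M, hM⟩ := hodd.pow (n := s)
  have hL : (∑ ij ∈ (Finset.range (p ^ s) ×ˢ Finset.range (p ^ s)).filter
          (fun ij : ℕ × ℕ => ij.1 + ij.2 ≤ p ^ s - 1),
        (4 * (ij.1 : ℚ) + 1) * (4 * (ij.2 : ℚ) + 1) *
          ((shiftedFactorial (1 / 2) ij.1 ^ 6 * shiftedFactorial (1 / 2) ij.2 ^ 6) /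
            (shiftedFactorial 1 ij.1 ^ 6 * shiftedFactorial 1 ij.2 ^ 6))) =
      sixthSum (M + 1) ^ 2 + 2 * ∑ j ∈ Finset.Ico (M + 1) (2 * M + 1),
        (4 * (j : ℚ) + 1) * risingBinom (1 / 2) j ^ 6 * sixthSum (p ^ s - j) := by
    have h := triangle_sum (fun k => (4 * (k : ℚ) + 1) * risingBinom (1 / 2) k ^ 6) M
    simp only [sixthSum, hM]
    rw [← h, Finset.sum_filter, Finset.sum_product]
    refine Finset.sum_congr rfl fun i _ => Finset.sum_congr rfl fun j _ => ?_
    simp only [mul_div_mul_comm, ← div_pow, shiftedFactorial_div]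
    refine if_congr (by omega) (by ring) rfl
  have hMM : (p ^ s - 1) / 2 = M := by omega
  rw [hL, hMM]
  simp only [← div_pow, shiftedFactorial_div]
  apply PDvd.ratCongr
  have hn : (p : ℚ) ^ (2 * s) = ((p : ℚ) ^ s) ^ 2 := by rw [mul_comm, pow_mul]
  have hH : ∑ k ∈ Finset.range (M + 1), risingBinom (1 / 2) k ^ 4 *
      (1 - 2 * (p : ℚ) ^ (2 * s) * harmonicTwo (2 * k)) =
      ∑ k ∈ Finset.range (M + 1), risingBinom (1 / 2) k ^ 4 - 2 * ∑ k ∈ Finset.range (M + 1),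
        risingBinom (1 / 2) k ^ 4 * (((p : ℚ) ^ s) ^ 2 * harmonicTwo (2 * k)) := by
    rw [Finset.mul_sum, ← Finset.sum_sub_distrib]
    exact Finset.sum_congr rfl fun k _ => by rw [hn]; ring
  have h5 := PDvd.sixthSum_sub hs hodd hM
  have hS := PDvd.sixthSum_middle hodd hM
  have hC : ∑ k ∈ Finset.range (M + 1), risingBinom (1 / 2) k ^ 4 *
      (1 - ((p : ℚ) ^ s) ^ 2 * harmonicTwo (2 * k)) =
      ∑ k ∈ Finset.range (M + 1), risingBinom (1 / 2) k ^ 4 - ∑ k ∈ Finset.range (M + 1),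
        risingBinom (1 / 2) k ^ 4 * (((p : ℚ) ^ s) ^ 2 * harmonicTwo (2 * k)) := by
    rw [← Finset.sum_sub_distrib]
    exact Finset.sum_congr rfl fun k _ => by ring
  have ha : ∀ k, PDvd p 0 (risingBinom (1 / 2) k ^ 4) := fun k => by
    simpa using (PDvd.risingBinom_half (p := p) hodd k).pow 4
  have hA : PDvd p 0 (∑ k ∈ Finset.range (M + 1), risingBinom (1 / 2) k ^ 4) :=
    PDvd.sum fun k _ => ha k
  have hB : PDvd p 2 (∑ k ∈ Finset.range (M + 1), risingBinom (1 / 2) k ^ 4 *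
      (((p : ℚ) ^ s) ^ 2 * harmonicTwo (2 * k))) := PDvd.sum fun k hk =>
    (ha k).mul_left (PDvd.harmonicTwo hM (Nat.lt_succ_iff.1 (Finset.mem_range.1 hk)))
  have hT : PDvd p (s + 5) (∑ j ∈ Finset.Ico (M + 1) (2 * M + 1),
      (4 * (j : ℚ) + 1) * risingBinom (1 / 2) j ^ 6 * sixthSum (p ^ s - j)) :=
    PDvd.sum fun j hj => by
      rw [Finset.mem_Ico] at hj
      exact PDvd.tail_mul_sixthSum hodd (by omega) (by omega)
  have h2 : PDvd p 0 (2 : ℚ) := by simpa using PDvd.nat p 2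
  have hp_s := PDvd.prime_pow p s
  rw [hC] at h5
  rw [hH, hn]
  set A := ∑ k ∈ Finset.range (M + 1), risingBinom (1 / 2) k ^ 4
  set B := ∑ k ∈ Finset.range (M + 1), risingBinom (1 / 2) k ^ 4 *
    (((p : ℚ) ^ s) ^ 2 * harmonicTwo (2 * k))
  set S := sixthSum (M + 1)
  set n := (p : ℚ) ^ s
  set T := ∑ j ∈ Finset.Ico (M + 1) (2 * M + 1),
      (4 * (j : ℚ) + 1) * risingBinom (1 / 2) j ^ 6 * sixthSum (p ^ s - j)
  -- The three summands have p-adic orders at least s + 5, s + 5 and 2s + 4; the last suffices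
  -- because s ≥ 1.
  have e : S ^ 2 + 2 * T - n ^ 2 * A * (A - 2 * B) =
      (S + n * (A - B)) * (S - n * (A - B)) + 2 * T + (n * n) * (B * B) := by ring
  rw [e]
  refine ((PDvd.mul ?_ h5).add (h2.mul_left hT)).add (((hp_s.mul hp_s).mul (hB.mul hB)).mono
    (by omega))
  exact hS.add (hp_s.mul_right (hA.sub hB.integral))
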